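/- **Setting.** A measurement over a complex Hilbert space $K$ is a countable family $(L_i)_{i\in I}$ of bounded operators on $K$ with $\sum_{i\in I}L_i^\dagger L_i=\mathrm{Id}$ in the weak operator topology. A density operator on $K$ is a nonzero positive trace-class operator (not necessarily normalized). Let $H$ and $A$ be complex Hilbert spaces. A quantum circuit $\mathcal C$ with principal inputs and outputs in $H$, and with ancillas and garbage hosted by $A$, consists of the following. - Finitely many wires, each carrying a separable Hilbert space, and unitary identifications of $H\otimes A$ with the tensor product of the wire spaces at the beginning and at the end of the computation; a fixed unit vector $|a\rangle\in A$ (the initial state of the ancillas). - Finitely many gates. Each gate $G$ acts on a set of wires and has a finite nonempty set of measurements over the tensor product of the spaces of these wires; distinct measurements of $G$ have disjoint outcome sets. (A unitary gate is a gate with a single measurement that has a single outcome.) - For each gate $G$ a set $\mathrm{CS}(G)$ of gates (its classical sources) and a selection function $\Sigma_G$, which assigns to every family $(o_F)_{F\in \mathrm{CS}(G)}$ of outcomes of the classical sources a measurement of $G$, and whose range is the set of all measurements of $G$. - A schedule, that is, a partition of the gates into consecutively executed sets $B_1,\dots,B_N$, such that gates in the same $B_n$ act on disjoint sets of wires, and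 the classical sources of a gate in $B_n$ belong to $\bigcup_{k<n}B_k$. A computation path $\mu$ through $\mathcal C$ assigns to each gate $G$ an outcome $\mu(G)$ of the measurement $\Sigma_G\bigl((\mu(F))_{F\in \mathrm{CS}(G)}\bigr)$. Let $C_\mu$ be the operator on $H\otimes A$ obtained by applying, for $n=1,\dots,N$ in this order, the tensor product of the operators with outcomes $\mu(G)$, $G\in B_n$, and the identity on the remaining wires. On the full input $\sigma$, the output along $\mu$ is $\mathrm{Out}_{\mathcal C}(\mu|\sigma)=C_\mu\sigma C_\mu^\dagger$. Let $U$ be a linear operator on $H$. The circuit $\mathcal C$ *computes $U$ along $\mu$* if for every density operator $\rho$ on $H$ there is a scalar $c\ge 0$ with $$\mathrm{Tr}_A\bigl(\mathrm{Out}_{\mathcal C}(\mu\,|\,\rho\otimes|a\rangle\langle a|)\bigr)=c\;U\rho\,U^\dagger .$$ **Corollary.** Suppose that $H$ is finite dimensional. If a quantum circuit $\mathcal C$ computes the same linear operator $U$ on $H$ along every computation path, then $U$ is unitary up to a positive scalar factor: there are a real number $t>0$ and a unitary operator $V$ on $H$ with $U=tV$. -/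

import Mathlib

open scoped TensorProduct

/-! ### Quantum registers -/

/-- The Hilbert space `ℓ²(I)`. For countable `I` this is, up to a unitary, the general separable
complex Hilbert space, written in an orthonormal basis indexed by `I`. -/
abbrev L2 (I : Type) : Type := lp (fun _ : I => ℂ) 2

namespace L2

theorem summable_sq {I : Type} (f : L2 I) : Summable fun i => ‖f i‖ ^ 2 := by
  have h := (lp.memℓp f).summable (by norm_num)
  simpa using h

theorem norm_sq {I : Type} (f : L2 I) : ‖f‖ ^ 2 = ∑' i, ‖f i‖ ^ 2 := by
  have h := lp.norm_rpow_eq_tsum (p := 2) (by norm_num) f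
  simpa using h

theorem memℓp {I : Type} {f : I → ℂ} (hf : Summable fun i => ‖f i‖ ^ 2) : Memℓp f 2 :=
  memℓp_gen (by simpa using hf)

variable {I J K : Type}

theorem summable_sq_equiv (e : K ≃ I × J) (f : L2 K) :
    Summable fun p : J × I => ‖f (e.symm (p.2, p.1))‖ ^ 2 :=
  (((Equiv.prodComm J I).trans e.symm).summable_iff
    (f := fun k => ‖f k‖ ^ 2)).2 (summable_sq f)

/-- For `e : K ≃ I × J`, a vector `f` of `ℓ²(K) = ℓ²(I) ⊗ ℓ²(J)` is `∑ j, (slice e f j) ⊗ δ_j`. -/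
noncomputable def slice (e : K ≃ I × J) (f : L2 K) (j : J) : L2 I :=
  ⟨fun i => f (e.symm (i, j)), memℓp ((summable_sq_equiv e f).prod_factor j)⟩

@[simp] theorem slice_apply (e : K ≃ I × J) (f : L2 K) (j : J) (i : I) :
    slice e f j i = f (e.symm (i, j)) := rfl

theorem hasSum_norm_sq_slice (e : K ≃ I × J) (f : L2 K) :
    HasSum (fun j => ‖slice e f j‖ ^ 2) (‖f‖ ^ 2) := by
  have h := summable_sq_equiv e f
  have h1 : ∑' p : J × I, ‖f (e.symm (p.2, p.1))‖ ^ 2 = ‖f‖ ^ 2 := by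
    rw [norm_sq]
    exact ((Equiv.prodComm J I).trans e.symm).tsum_eq (fun k => ‖f k‖ ^ 2)
  have h2 := h.hasSum
  rw [h1] at h2
  refine h2.prod_fiberwise fun j => ?_
  rw [norm_sq]
  exact (summable_sq (slice e f j)).hasSum

theorem summable_lift (e : K ≃ I × J) (T : L2 I →L[ℂ] L2 I) (f : L2 K) :
    Summable fun p : J × I => ‖T (slice e f p.1) p.2‖ ^ 2 := by
  rw [summable_prod_of_nonneg (fun p => by positivity)]
  refine ⟨fun j => summable_sq (T (slice e f j)), ?_⟩
  refine Summable.of_nonneg_of_le (fun j => tsum_nonneg fun i => by positivity) (fun j => ?_)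
    ((hasSum_norm_sq_slice e f).summable.mul_left (‖T‖ ^ 2))
  rw [← norm_sq (T (slice e f j)), ← mul_pow]
  exact pow_le_pow_left₀ (norm_nonneg _) (T.le_opNorm _) 2

theorem summable_lift' (e : K ≃ I × J) (T : L2 I →L[ℂ] L2 I) (f : L2 K) :
    Summable fun k : K => ‖T (slice e f (e k).2) (e k).1‖ ^ 2 :=
  ((e.trans (Equiv.prodComm I J)).summable_iff
    (f := fun p : J × I => ‖T (slice e f p.1) p.2‖ ^ 2)).2 (summable_lift e T f)

/-- The vector `(T ⊗ 1) f` of `ℓ²(K) = ℓ²(I) ⊗ ℓ²(J)`, for `e : K ≃ I × J`. -/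
noncomputable def liftFun (e : K ≃ I × J) (T : L2 I →L[ℂ] L2 I) (f : L2 K) : L2 K :=
  ⟨fun k => T (slice e f (e k).2) (e k).1, memℓp (summable_lift' e T f)⟩

theorem liftFun_apply (e : K ≃ I × J) (T : L2 I →L[ℂ] L2 I) (f : L2 K) (k : K) :
    liftFun e T f k = T (slice e f (e k).2) (e k).1 := rfl

theorem norm_liftFun_le (e : K ≃ I × J) (T : L2 I →L[ℂ] L2 I) (f : L2 K) :
    ‖liftFun e T f‖ ≤ ‖T‖ * ‖f‖ := by
  have hb : ∀ j, ‖T (slice e f j)‖ ^ 2 ≤ ‖T‖ ^ 2 * ‖slice e f j‖ ^ 2 := fun j => by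
    rw [← mul_pow]
    exact pow_le_pow_left₀ (norm_nonneg _) (T.le_opNorm _) 2
  have hs := (hasSum_norm_sq_slice e f).mul_left (‖T‖ ^ 2)
  have h1 : ‖liftFun e T f‖ ^ 2 = ∑' j, ‖T (slice e f j)‖ ^ 2 := by
    rw [norm_sq]
    simp only [liftFun_apply, norm_sq (T _)]
    rw [← (summable_lift e T f).tsum_prod, ← (e.trans (Equiv.prodComm I J)).tsum_eq]
    rfl
  have h3 : ‖liftFun e T f‖ ^ 2 ≤ (‖T‖ * ‖f‖) ^ 2 := by
    rw [h1, mul_pow, ← hs.tsum_eq]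
    exact Summable.tsum_le_tsum hb
      (Summable.of_nonneg_of_le (fun j => sq_nonneg _) hb hs.summable) hs.summable
  exact le_of_sq_le_sq h3 (by positivity)

theorem slice_add (e : K ≃ I × J) (f g : L2 K) (j : J) :
    slice e (f + g) j = slice e f j + slice e g j := by
  ext i; simp

theorem slice_smul (e : K ≃ I × J) (c : ℂ) (f : L2 K) (j : J) :
    slice e (c • f) j = c • slice e f j := by
  ext i; simp

theorem liftFun_add (e : K ≃ I × J) (T : L2 I →L[ℂ] L2 I) (f g : L2 K) :
    liftFun e T (f + g) = liftFun e T f + liftFun e T g := by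
  ext k
  rw [lp.coeFn_add, Pi.add_apply]
  simp only [liftFun_apply, slice_add, map_add, lp.coeFn_add, Pi.add_apply]

theorem liftFun_smul (e : K ≃ I × J) (T : L2 I →L[ℂ] L2 I) (c : ℂ) (f : L2 K) :
    liftFun e T (c • f) = c • liftFun e T f := by
  ext k
  rw [lp.coeFn_smul, Pi.smul_apply]
  simp only [liftFun_apply, slice_smul, map_smul, lp.coeFn_smul, Pi.smul_apply]

/-- For `e : K ≃ I × J` and an operator `T` on `ℓ²(I)`, the operator `T ⊗ 1` on
`ℓ²(K) = ℓ²(I) ⊗ ℓ²(J)`. -/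
noncomputable def lift (e : K ≃ I × J) (T : L2 I →L[ℂ] L2 I) : L2 K →L[ℂ] L2 K :=
  LinearMap.mkContinuous
    { toFun := liftFun e T
      map_add' := liftFun_add e T
      map_smul' := liftFun_smul e T }
    ‖T‖ (norm_liftFun_le e T)

@[simp] theorem lift_apply (e : K ≃ I × J) (T : L2 I →L[ℂ] L2 I) (f : L2 K) (k : K) :
    lift e T f k = T (slice e f (e k).2) (e k).1 := rfl

end L2

/-- The Hilbert space of the set `S` of wires when wire `w` carries the Hilbert space
`ℓ²(B w)`: the tensor product of the `ℓ²(B w)`, `w ∈ S`, in its product basis. -/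
abbrev Register {n : ℕ} (B : Fin n → Type) (S : Finset (Fin n)) : Type :=
  L2 (∀ w : {w // w ∈ S}, B w)

/-- The Hilbert space of all the wires. -/
abbrev FullRegister {n : ℕ} (B : Fin n → Type) : Type :=
  L2 (∀ w, B w)

/-- An operator `T` on the wires in `S`, applied to the register of all wires: it is `T` on the
wires in `S`, tensored with the identity on the other wires. -/
noncomputable def applyOn {n : ℕ} {B : Fin n → Type} (S : Finset (Fin n))
    (T : Register B S →L[ℂ] Register B S) : FullRegister B →L[ℂ] FullRegister B :=
  L2.lift (Equiv.piEquivPiSubtypeProd (fun w => w ∈ S) B) T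

/-! ### Measurements, density operators, tensor products and partial traces -/

/-- A (general) measurement over the Hilbert space `K` with outcome set `I`. -/
structure Measurement (I : Type) (K : Type*) [NormedAddCommGroup K] [InnerProductSpace ℂ K]
    [CompleteSpace K] where
  /-- the operator `L i` of the outcome `i` -/
  op : I → K →L[ℂ] K
  /-- `∑ i, (L i)† (L i) = 1` in the weak operator topology -/
  hasSum : HasSum
    (fun i => ContinuousLinearMapWOT.ofCLM (ContinuousLinearMap.adjoint (op i) ∘L op i))
    (ContinuousLinearMapWOT.ofCLM (ContinuousLinearMap.id ℂ K))

/-- Density operators, not necessarily normalized: the nonzero positive operators with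
finite trace. -/
structure IsDensity {H : Type*} [NormedAddCommGroup H] [InnerProductSpace ℂ H]
    (ρ : H →L[ℂ] H) : Prop where
  ne_zero : ρ ≠ 0
  isPositive : ρ.IsPositive
  summable_trace : ∀ (s : Set H) (e : HilbertBasis s ℂ H),
    Summable fun k => (inner ℂ (e k) (ρ (e k))).re

/-- The Hilbert space tensor product of `H` and `A`. -/
abbrev HTensor (H A : Type*) [NormedAddCommGroup H] [InnerProductSpace ℂ H]
    [NormedAddCommGroup A] [InnerProductSpace ℂ A] : Type _ :=
  UniformSpace.Completion (H ⊗[ℂ] A)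

section Tensor

variable {H A : Type*} [NormedAddCommGroup H] [InnerProductSpace ℂ H]
  [NormedAddCommGroup A] [InnerProductSpace ℂ A]

/-- The operator `ψ ↦ ψ ⊗ a`. -/
noncomputable def tensorRight (H : Type*) [NormedAddCommGroup H] [InnerProductSpace ℂ H]
    (a : A) : H →L[ℂ] HTensor H A :=
  UniformSpace.Completion.toComplL ∘L (TensorProduct.mkL ℂ H A).flip a

/-- The operator `ρ ⊗ |a⟩⟨a|`, written as `(· ⊗ a) ∘ ρ ∘ (· ⊗ a)†`. -/
noncomputable def tensorKetBra [CompleteSpace H] (ρ : H →L[ℂ] H) (a : A) :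
    HTensor H A →L[ℂ] HTensor H A :=
  tensorRight H a ∘L ρ ∘L ContinuousLinearMap.adjoint (tensorRight H a)

/-- `S` is the partial trace over `A` of the operator `T` on `H ⊗ A`: in every Hilbert basis `e`
of `A`, `⟨φ, S ψ⟩ = ∑ k, ⟨φ ⊗ e k, T (ψ ⊗ e k)⟩`. -/
def IsPartialTrace (T : HTensor H A →L[ℂ] HTensor H A) (S : H →L[ℂ] H) : Prop :=
  ∀ (s : Set A) (e : HilbertBasis s ℂ A) (φ ψ : H),
    HasSum (fun k => inner ℂ (tensorRight H (e k : A) φ) (T (tensorRight H (e k : A) ψ)))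
      (inner ℂ φ (S ψ))

end Tensor

/-! ### Quantum circuits -/

/-- A quantum circuit with classical channels and a fixed execution schedule. Its principal inputs
and outputs are states in `H`, and the ancillas and the garbage are hosted by `A`.
The gates are listed in some fixed linear order. -/
structure QuantumCircuit (H A : Type*) [NormedAddCommGroup H] [InnerProductSpace ℂ H]
    [NormedAddCommGroup A] [InnerProductSpace ℂ A] where
  /-- the number of quantum wires -/
  numWires : ℕ
  /-- the orthonormal basis of the Hilbert space of each wire -/
  Basis : Fin numWires → Type
  countable_basis : ∀ w, Countable (Basis w)
  /-- how `H ⊗ A` is carried by the wires at the beginning of the computation -/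
  input : HTensor H A ≃ₗᵢ[ℂ] FullRegister Basis
  /-- how `H ⊗ A` is carried by the wires at the end of the computation -/
  output : FullRegister Basis ≃ₗᵢ[ℂ] HTensor H A
  /-- the initial pure state of the ancillas -/
  ancilla : A
  norm_ancilla : ‖ancilla‖ = 1
  /-- the number of gates -/
  numGates : ℕ
  /-- the wires through each gate -/
  wires : Fin numGates → Finset (Fin numWires)
  /-- the finite nonempty set of measurements of each gate -/
  MeasIndex : Fin numGates → Type
  finite_measIndex : ∀ g, Finite (MeasIndex g)
  nonempty_measIndex : ∀ g, Nonempty (MeasIndex g)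
  /-- the outcomes of each measurement of each gate -/
  Outcome : ∀ g, MeasIndex g → Type
  countable_outcome : ∀ g m, Countable (Outcome g m)
  /-- the measurements of each gate -/
  meas : ∀ g m, Measurement (Outcome g m) (Register Basis (wires g))
  /-- the classical sources of each gate -/
  sources : Fin numGates → Finset (Fin numGates)
  /-- the selection function of each gate, defined on the outcomes of its classical sources; the
  outcome sets of distinct measurements of a gate are disjoint, so an outcome of a gate is a pair
  of a measurement of the gate and an outcome of that measurement -/
  select : ∀ g, (∀ f : {f // f ∈ sources g}, Σ m : MeasIndex f, Outcome f m) → MeasIndex g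
  /-- there are no superfluous measurements -/
  select_surjective : ∀ g, Function.Surjective (select g)
  /-- the length of the schedule -/
  depth : ℕ
  /-- the schedule: the `n`-th bout is the set of the gates `g` with `stage g = n` -/
  stage : Fin numGates → Fin depth
  /-- classical prerequisites fire earlier -/
  stage_lt : ∀ g, ∀ f ∈ sources g, stage f < stage g
  /-- gates that fire simultaneously act on distinct wires, so that gates with a common wire are
  ordered by the schedule, and quantum prerequisites fire earlier -/
  disjoint_wires : ∀ f g, f ≠ g → stage f = stage g → Disjoint (wires f) (wires g)

namespace QuantumCircuit

variable {H A : Type*} [NormedAddCommGroup H] [InnerProductSpace ℂ H]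
  [NormedAddCommGroup A] [InnerProductSpace ℂ A]

/-- A computation path: an outcome for every gate, of the measurement that is selected by the
outcomes of the classical sources of the gate. -/
structure Path (C : QuantumCircuit H A) where
  outcome : ∀ g, Σ m : C.MeasIndex g, C.Outcome g m
  coherent : ∀ g, (outcome g).1 = C.select g fun f => outcome f

/-- The operator of the gate `g` along the path `μ`, on the register of all wires. -/
noncomputable def gateOp (C : QuantumCircuit H A) (μ : C.Path) (g : Fin C.numGates) :
    FullRegister C.Basis →L[ℂ] FullRegister C.Basis :=
  applyOn (C.wires g) ((C.meas g (μ.outcome g).1).op (μ.outcome g).2)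

/-- The operator of the `n`-th bout along the path `μ`: the tensor product of the operators of
its gates, that is, the product of the operators of its gates on the register of all wires
(their order does not matter, since these gates act on distinct wires). -/
noncomputable def boutOp (C : QuantumCircuit H A) (μ : C.Path) (n : Fin C.depth) :
    FullRegister C.Basis →L[ℂ] FullRegister C.Basis :=
  (((List.finRange C.numGates).filter fun g => C.stage g = n).reverse.map (C.gateOp μ)).prod

/-- The operator of the whole circuit along the path `μ`, as an operator on `H ⊗ A`: the bouts
are executed one after the other, the first bout first. -/
noncomputable def pathOp (C : QuantumCircuit H A) (μ : C.Path) :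
    HTensor H A →L[ℂ] HTensor H A :=
  (C.output : FullRegister C.Basis →L[ℂ] HTensor H A) ∘L
    ((List.finRange C.depth).reverse.map (C.boutOp μ)).prod ∘L
      (C.input : HTensor H A →L[ℂ] FullRegister C.Basis)

/-- The output of the circuit on the full input `σ` if the computation follows the path `μ`
(the post-measurement state, with the operators `L σ L†` as unnormalized
post-measurement states). -/
noncomputable def out (C : QuantumCircuit H A) (μ : C.Path)
    (σ : HTensor H A →L[ℂ] HTensor H A) : HTensor H A →L[ℂ] HTensor H A :=
  C.pathOp μ ∘L σ ∘L ContinuousLinearMap.adjoint (C.pathOp μ)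

/-- The circuit computes the linear operator `U` along the path `μ`: for every principal input `ρ`
with full input `ρ ⊗ |a⟩⟨a|`, the principal output (the partial trace over `A` of the output)
agrees with `U ρ U†` up to a nonnegative scalar factor. The factor `0` is for the inputs on which
the computation follows `μ` with probability `0`, so that the output along `μ` is `0`. -/
def ComputesAlong [CompleteSpace H] (C : QuantumCircuit H A) (μ : C.Path)
    (U : H →L[ℂ] H) : Prop :=
  ∀ ρ : H →L[ℂ] H, IsDensity ρ → ∃ c : ℝ, 0 ≤ c ∧
    IsPartialTrace (C.out μ (tensorKetBra ρ C.ancilla))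
      ((c : ℂ) • (U ∘L ρ ∘L ContinuousLinearMap.adjoint U))

end QuantumCircuit

/-! Along one path μ, the input |ψ⟩⟨ψ| ⊗ |a⟩⟨a| yields the pure state of C_μ(ψ ⊗ a), and its partial
trace is c · |Uψ⟩⟨Uψ|. Taking traces gives ‖C_μ(ψ ⊗ a)‖² = c‖Uψ‖². When U is injective, c does not
depend on ψ for ψ ≠ 0: if Uψ and Uφ are independent, feed in |ψ⟩⟨ψ| + |φ⟩⟨φ| and compare
coefficients; if they are dependent, ψ and φ are proportional. So ‖Uψ‖ = ‖Uφ‖ forces equal output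
norms along every path (`ComputesAlong.norm_pathOp_eq`).

Conversely, measurements conserve total probability, so the output norms along all paths determine
the norm of the input (`norm_eq_of_forall_norm_pathOp_eq`). This is proved gate by gate, backwards
through the schedule, with no sum over paths.

Together these show that U is injective and that ‖Uψ‖ = ‖Uφ‖ implies ‖ψ‖ = ‖φ‖. By homogeneity U is
a positive multiple of an isometry, which is unitary in finite dimension. -/

/-! ### Conservation of probability under measurements, also of a subsystem -/

section MeasurementNorm

variable {K : Type*} [NormedAddCommGroup K] [InnerProductSpace ℂ K] [CompleteSpace K]

/-- The probabilities of the outcomes of a measurement add up to `1`. -/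
theorem Measurement.hasSum_norm_sq {I : Type} (M : Measurement I K) (x : K) :
    HasSum (fun i => ‖M.op i x‖ ^ 2) (‖x‖ ^ 2) := by
  have hc : Continuous fun T : K →WOT[ℂ] K => inner ℂ x (T x) :=
    ContinuousLinearMapWOT.continuous_dual_apply x (innerSL ℂ x)
  let φ : (K →WOT[ℂ] K) →+ ℂ :=
    { toFun := fun T => inner ℂ x (T x)
      map_zero' := by simp
      map_add' := fun S T => by simp }
  have h := M.hasSum.map φ hc
  have h2 := Complex.hasSum_re h
  have e1 : (φ (ContinuousLinearMapWOT.ofCLM (ContinuousLinearMap.id ℂ K))).re = ‖x‖ ^ 2 := by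
    change (inner ℂ x x : ℂ).re = _
    exact inner_self_eq_norm_sq (𝕜 := ℂ) x
  rw [e1] at h2
  convert h2 using 1
  funext i
  symm
  change (inner ℂ x ((ContinuousLinearMap.adjoint (M.op i)) (M.op i x)) : ℂ).re = _
  rw [ContinuousLinearMap.adjoint_inner_right]
  exact inner_self_eq_norm_sq (𝕜 := ℂ) _

end MeasurementNorm

namespace L2

variable {I J K : Type}

/-- Slices are orthogonal components, on each of which T ⊗ 1 acts as T. Values in `ENNReal` let the
sums over slices and over outcomes be exchanged without summability conditions. -/
theorem ofReal_norm_sq_lift (e : K ≃ I × J) (T : L2 I →L[ℂ] L2 I) (f : L2 K) :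
    ENNReal.ofReal (‖lift e T f‖ ^ 2) = ∑' j, ENNReal.ofReal (‖T (slice e f j)‖ ^ 2) := by
  have hb : ∀ j, ‖T (slice e f j)‖ ^ 2 ≤ ‖T‖ ^ 2 * ‖slice e f j‖ ^ 2 := fun j => by
    rw [← mul_pow]
    exact pow_le_pow_left₀ (norm_nonneg _) (T.le_opNorm _) 2
  have hs := (hasSum_norm_sq_slice e f).mul_left (‖T‖ ^ 2)
  have h1 : ‖lift e T f‖ ^ 2 = ∑' j, ‖T (slice e f j)‖ ^ 2 := by
    rw [norm_sq]
    simp only [lift_apply, norm_sq (T _)]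
    rw [← (summable_lift e T f).tsum_prod, ← (e.trans (Equiv.prodComm I J)).tsum_eq]
    rfl
  rw [h1, ENNReal.ofReal_tsum_of_nonneg (fun _ => by positivity)
    (Summable.of_nonneg_of_le (fun j => sq_nonneg _) hb hs.summable)]

/-- A measurement of a subsystem is norm preserving on the whole system. -/
theorem tsum_norm_sq_lift {O : Type} (e : K ≃ I × J) (M : Measurement O (L2 I)) (f : L2 K) :
    ∑' o, ENNReal.ofReal (‖lift e (M.op o) f‖ ^ 2) = ENNReal.ofReal (‖f‖ ^ 2) := by
  simp only [ofReal_norm_sq_lift]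
  rw [ENNReal.tsum_comm]
  rw [← (hasSum_norm_sq_slice e f).tsum_eq, ENNReal.ofReal_tsum_of_nonneg
    (fun _ => by positivity) (hasSum_norm_sq_slice e f).summable]
  refine tsum_congr fun j => ?_
  have h := M.hasSum_norm_sq (slice e f j)
  rw [← h.tsum_eq, ENNReal.ofReal_tsum_of_nonneg (fun _ => by positivity) h.summable]

theorem norm_eq_of_forall_norm_lift_eq {O : Type} (e : K ≃ I × J) (M : Measurement O (L2 I))
    {f g : L2 K} (h : ∀ o, ‖lift e (M.op o) f‖ = ‖lift e (M.op o) g‖) : ‖f‖ = ‖g‖ := by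
  have h1 := tsum_norm_sq_lift e M f
  simp only [h, tsum_norm_sq_lift e M g] at h1
  rw [ENNReal.ofReal_eq_ofReal_iff (by positivity) (by positivity)] at h1
  exact ((sq_eq_sq₀ (norm_nonneg _) (norm_nonneg _)).1 h1).symm

end L2

/-! ### Path outputs determine the norm of the input -/

namespace QuantumCircuit

variable {H A : Type*} [NormedAddCommGroup H] [InnerProductSpace ℂ H]
  [NormedAddCommGroup A] [InnerProductSpace ℂ A]

/-- The operator of an outcome of the gate `g`, on the register of all wires. -/
noncomputable def outcomeOp (C : QuantumCircuit H A) (g : Fin C.numGates)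
    (o : Σ m : C.MeasIndex g, C.Outcome g m) :
    FullRegister C.Basis →L[ℂ] FullRegister C.Basis :=
  applyOn (C.wires g) ((C.meas g o.1).op o.2)

/-- If the gates outside the list `l` have fired with outcomes `o`, and two states have the same
norm after every continuation of the computation through `l`, then they have the same norm. -/
theorem norm_eq_of_forall_continuation (C : QuantumCircuit H A) (l : List (Fin C.numGates))
    (hnd : l.Nodup) (hord : l.Pairwise fun f g => C.stage f ≤ C.stage g)
    (o : ∀ g, Σ m : C.MeasIndex g, C.Outcome g m)
    (ho : ∀ g ∉ l, (o g).1 = C.select g (fun f => o f) ∧ ∀ f ∈ C.sources g, f ∉ l)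
    (x y : FullRegister C.Basis)
    (h : ∀ μ : C.Path, (∀ g ∉ l, μ.outcome g = o g) →
      ‖((l.reverse.map (C.gateOp μ)).prod) x‖ = ‖((l.reverse.map (C.gateOp μ)).prod) y‖) :
    ‖x‖ = ‖y‖ := by
  induction l generalizing o x y with
  -- With no gate left to fire, `o` is coherent everywhere, hence itself a path.
  | nil => simpa using h ⟨o, fun g => (ho g (by simp)).1⟩ (by simp)
  | cons g l ih =>
    have hgl : g ∉ l := (List.nodup_cons.1 hnd).1
    -- The sources of `g` have strictly smaller stage, while the gates of `g :: l` have stage at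
    -- least that of `g`. So the measurement of `g` is already decided by `o`.
    have hsrc : ∀ f ∈ C.sources g, f ∉ g :: l := fun f hf hm => by
      have hlt := C.stage_lt g f hf
      rcases List.mem_cons.1 hm with rfl | hm
      · exact lt_irrefl _ hlt
      · exact absurd ((List.pairwise_cons.1 hord).1 f hm) (not_le.2 hlt)
    refine L2.norm_eq_of_forall_norm_lift_eq
      (Equiv.piEquivPiSubtypeProd (fun w => w ∈ C.wires g) C.Basis)
      (C.meas g (C.select g fun f => o f)) fun i => ?_
    -- Recording outcome `i` at `g` alters no selection by a gate that does not have `g` as a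
    -- source.
    have hsel : ∀ k, (∀ f ∈ C.sources k, f ≠ g) →
        (C.select k fun f => Function.update o g ⟨C.select g fun f => o f, i⟩ f) =
          C.select k fun f => o f := fun k hk => by
      congr 1
      funext f
      exact Function.update_of_ne (hk f f.2) _ _
    refine ih (List.nodup_cons.1 hnd).2 (List.pairwise_cons.1 hord).2
      (Function.update o g ⟨C.select g fun f => o f, i⟩) (fun k hk => ?_) _ _ fun μ hμ => ?_
    · rcases eq_or_ne k g with rfl | hkg
      · refine ⟨?_, fun f hf hm => hsrc f hf (List.mem_cons_of_mem _ hm)⟩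
        rw [hsel k fun f hf hfk => hsrc f hf (hfk ▸ List.mem_cons_self), Function.update_self]
      · have hk' := ho k (by simp [hkg, hk])
        refine ⟨?_, fun f hf hm => hk'.2 f hf (List.mem_cons_of_mem _ hm)⟩
        rw [hsel k fun f hf hfk => hk'.2 f hf (hfk ▸ List.mem_cons_self),
          Function.update_of_ne hkg]
        exact hk'.1
    · have hμ' := h μ fun k hk => by
        rw [hμ k fun hm => hk (List.mem_cons_of_mem _ hm), Function.update_of_ne]
        rintro rfl
        exact hk List.mem_cons_self
      have hg : C.gateOp μ g = C.outcomeOp g ⟨C.select g fun f => o f, i⟩ := by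
        change C.outcomeOp g (μ.outcome g) = _
        rw [hμ g hgl, Function.update_self]
      simp only [List.reverse_cons, List.map_append, List.prod_append, List.map_cons, List.map_nil,
        List.prod_singleton, hg] at hμ'
      exact hμ'

/-- The gates in the order of execution. -/
def schedule (C : QuantumCircuit H A) : List (Fin C.numGates) :=
  (List.finRange C.depth).flatMap fun n =>
    (List.finRange C.numGates).filter fun g => C.stage g = n

theorem mem_schedule (C : QuantumCircuit H A) (g : Fin C.numGates) : g ∈ C.schedule := by
  simp [schedule]

theorem nodup_schedule (C : QuantumCircuit H A) : C.schedule.Nodup := by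
  rw [schedule, List.nodup_flatMap]
  refine ⟨fun n _ => (List.nodup_finRange _).filter _, ?_⟩
  refine (List.nodup_finRange C.depth).imp fun {m n} hmn => ?_
  intro g hg hg'
  simp only [List.mem_filter, decide_eq_true_eq] at hg hg'
  exact hmn (hg.2.symm.trans hg'.2)

theorem pairwise_schedule (C : QuantumCircuit H A) :
    C.schedule.Pairwise fun f g => C.stage f ≤ C.stage g := by
  rw [schedule, List.pairwise_flatMap]
  refine ⟨fun n _ => List.pairwise_iff_forall_sublist.2 fun {f g} hfg => ?_, ?_⟩
  · have hf := hfg.subset (List.mem_cons_self (a := f))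
    have hg := hfg.subset (List.mem_cons_of_mem f (List.mem_singleton_self g))
    simp only [List.mem_filter, decide_eq_true_eq] at hf hg
    exact (hf.2.trans hg.2.symm).le
  · refine (List.pairwise_lt_finRange C.depth).imp fun {m n} hmn f hf g hg => ?_
    simp only [List.mem_filter, decide_eq_true_eq] at hf hg
    rw [hf.2, hg.2]
    exact hmn.le

/-- Concatenating the bouts turns the two-level product into one over a single list of gates, the
form needed for induction. -/
theorem prod_boutOp (C : QuantumCircuit H A) (μ : C.Path) :
    ((List.finRange C.depth).reverse.map (C.boutOp μ)).prod =
      (C.schedule.reverse.map (C.gateOp μ)).prod := by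
  rw [schedule]
  induction List.finRange C.depth with
  | nil => simp
  | cons n l ih =>
    simp only [List.reverse_cons, List.map_append, List.prod_append, ih, List.flatMap_cons,
      List.reverse_append, List.map_cons, List.map_nil, List.prod_singleton]
    rfl

/-- The total output of a circuit, over all computation paths, determines the norm of the input. -/
theorem norm_eq_of_forall_norm_pathOp_eq (C : QuantumCircuit H A) {x y : HTensor H A}
    (h : ∀ μ : C.Path, ‖C.pathOp μ x‖ = ‖C.pathOp μ y‖) : ‖x‖ = ‖y‖ := by
  rw [← C.input.norm_map x, ← C.input.norm_map y]
  -- An empty outcome set could leave the circuit without paths, making `h` vacuous. But then the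
  -- empty sum of that measurement is the identity, so its register is zero and all norms agree.
  by_cases hne : ∀ g m, Nonempty (C.Outcome g m)
  · have := C.nonempty_measIndex
    refine C.norm_eq_of_forall_continuation C.schedule C.nodup_schedule C.pairwise_schedule
      -- These outcomes are placeholders: the schedule contains every gate, so none of them is
      -- constrained or used.
      (fun g => ⟨Classical.arbitrary _, Classical.choice (hne g _)⟩)
      (fun g hg => absurd (C.mem_schedule g) hg) _ _ fun μ _ => ?_
    have hμ := h μ
    rw [← prod_boutOp]
    simpa [pathOp] using hμ
  · push Not at hne
    obtain ⟨g, m, hgm⟩ := hne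
    exact L2.norm_eq_of_forall_norm_lift_eq
      (Equiv.piEquivPiSubtypeProd (fun w => w ∈ C.wires g) C.Basis) (C.meas g m)
      fun i => (hgm.false i).elim

end QuantumCircuit

/-! ### Parseval's identity in the tensor product -/

section Tensor

variable {H A : Type*} [NormedAddCommGroup H] [InnerProductSpace ℂ H]
  [NormedAddCommGroup A] [InnerProductSpace ℂ A]

theorem tensorRight_apply (a : A) (φ : H) :
    tensorRight H a φ = ((φ ⊗ₜ[ℂ] a : H ⊗[ℂ] A) : HTensor H A) := rfl

theorem inner_tensorRight (a b : A) (φ ψ : H) :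
    inner ℂ (tensorRight H a φ) (tensorRight H b ψ) = inner ℂ φ ψ * inner ℂ a b := by
  rw [tensorRight_apply, tensorRight_apply, UniformSpace.Completion.inner_coe,
    TensorProduct.inner_tmul]

theorem norm_tensorRight (a : A) (φ : H) : ‖tensorRight H a φ‖ = ‖φ‖ * ‖a‖ := by
  rw [tensorRight_apply, UniformSpace.Completion.norm_coe, TensorProduct.norm_tmul]

theorem hasSum_norm_sq_inner_tensor {ι κ : Type*} [Fintype ι] (b : OrthonormalBasis ι ℂ H)
    (e : HilbertBasis κ ℂ A) (v : HTensor H A) :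
    HasSum (fun p : ι × κ => ‖(inner ℂ (tensorRight H (e p.2) (b p.1)) v : ℂ)‖ ^ 2) (‖v‖ ^ 2) := by
  classical
  have hon : Orthonormal ℂ fun p : ι × κ => tensorRight H (e p.2) (b p.1) := by
    rw [orthonormal_iff_ite]
    rintro ⟨i, k⟩ ⟨j, l⟩
    rw [inner_tensorRight, orthonormal_iff_ite.1 b.orthonormal, orthonormal_iff_ite.1 e.orthonormal]
    by_cases h1 : i = j <;> by_cases h2 : k = l <;> simp [h1, h2]
  -- A vector orthogonal to all b i ⊗ e k is orthogonal to all b i ⊗ a by density, then to all pure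
  -- tensors, to the algebraic tensor product, and to its completion.
  have hbot : (Submodule.span ℂ
      (Set.range fun p : ι × κ => tensorRight H (e p.2) (b p.1)))ᗮ = ⊥ := by
    rw [Submodule.eq_bot_iff]
    intro w hw
    have h0 : ∀ i k, inner ℂ w (tensorRight H (e k) (b i)) = 0 := fun i k =>
      (Submodule.mem_orthogonal' _ _).1 hw _ (Submodule.subset_span ⟨(i, k), rfl⟩)
    have h1 : ∀ i (a : A), inner ℂ w (tensorRight H a (b i)) = 0 := fun i a => by
      let F : A →L[ℂ] ℂ := innerSL ℂ w ∘L UniformSpace.Completion.toComplL ∘L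
        TensorProduct.mkL ℂ H A (b i)
      have hF : F = 0 := by
        refine ContinuousLinearMap.ext_on
          (Submodule.dense_iff_topologicalClosure_eq_top.2 e.dense_span) ?_
        rintro _ ⟨k, rfl⟩
        exact h0 i k
      exact DFunLike.congr_fun hF a
    have h2 : ∀ (φ : H) (a : A), inner ℂ w (tensorRight H a φ) = 0 := fun φ a => by
      rw [← b.sum_repr φ, map_sum, inner_sum]
      simp [inner_smul_right, h1]
    have h3 : ∀ t : H ⊗[ℂ] A, inner ℂ w (t : HTensor H A) = 0 := fun t => by
      induction t using TensorProduct.induction_on with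
      | zero => rw [UniformSpace.Completion.coe_zero, inner_zero_right]
      | tmul φ a => exact h2 φ a
      | add s t hs ht => rw [UniformSpace.Completion.coe_add, inner_add_right, hs, ht, add_zero]
    have h4 : ∀ t : HTensor H A, inner ℂ w t = 0 := fun t =>
      UniformSpace.Completion.induction_on t
        (isClosed_eq (continuous_const.inner continuous_id) continuous_const) h3
    exact inner_self_eq_zero.1 (h4 w)
  have h := (HilbertBasis.mkOfOrthogonalEqBot hon hbot).hasSum_inner_mul_inner v v
  rw [HilbertBasis.coe_mkOfOrthogonalEqBot] at h
  have h' := Complex.hasSum_re h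
  have e1 : (inner ℂ v v : ℂ).re = ‖v‖ ^ 2 := inner_self_eq_norm_sq (𝕜 := ℂ) v
  rw [e1] at h'
  convert h' using 1
  funext p
  rw [← inner_conj_symm v, Complex.conj_mul']
  norm_cast

end Tensor

theorem isDensity_of_finiteDimensional {H : Type*} [NormedAddCommGroup H] [InnerProductSpace ℂ H]
    [FiniteDimensional ℂ H] {ρ : H →L[ℂ] H} (h0 : ρ ≠ 0) (hρ : ρ.IsPositive) : IsDensity ρ where
  ne_zero := h0
  isPositive := hρ
  summable_trace := fun s e => by
    have : Finite s := e.orthonormal.linearIndependent.finite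
    exact Summable.of_finite

/-! ### Partial traces -/

section PartialTrace

variable {H A : Type*} [NormedAddCommGroup H] [InnerProductSpace ℂ H]
  [NormedAddCommGroup A] [InnerProductSpace ℂ A]

theorem IsPartialTrace.add {T T' : HTensor H A →L[ℂ] HTensor H A} {S S' : H →L[ℂ] H}
    (h : IsPartialTrace T S) (h' : IsPartialTrace T' S') : IsPartialTrace (T + T') (S + S') :=
  fun s e φ ψ => by
    simpa only [_root_.add_apply, inner_add_right] using (h s e φ ψ).add (h' s e φ ψ)

theorem IsPartialTrace.unique [CompleteSpace A] {T : HTensor H A →L[ℂ] HTensor H A}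
    {S S' : H →L[ℂ] H} (h : IsPartialTrace T S) (h' : IsPartialTrace T S') : S = S' := by
  obtain ⟨s, e, -⟩ := exists_hilbertBasis ℂ A
  ext ψ
  exact ext_inner_left ℂ fun φ => (h s e φ ψ).unique (h' s e φ ψ)

-- The partial trace preserves the trace: sum its diagonal entries over an orthonormal basis of H
-- and apply Parseval on both sides.
open InnerProductSpace in
theorem IsPartialTrace.norm_sq_eq [FiniteDimensional ℂ H] [CompleteSpace A] {v : HTensor H A}
    {u : H} {c : ℝ} (h : IsPartialTrace (rankOne ℂ v v) ((c : ℂ) • rankOne ℂ u u)) :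
    ‖v‖ ^ 2 = c * ‖u‖ ^ 2 := by
  obtain ⟨s, e, -⟩ := exists_hilbertBasis ℂ A
  let b := stdOrthonormalBasis ℂ H
  have key : ∀ z : ℂ, (z * (starRingEnd ℂ) z).re = ‖z‖ ^ 2 := fun z => by
    rw [Complex.mul_conj']; norm_cast
  have h1 : ∀ j, HasSum (fun k => ‖(inner ℂ (tensorRight H (e k) (b j)) v : ℂ)‖ ^ 2)
      (c * ‖(inner ℂ (b j) u : ℂ)‖ ^ 2) := fun j => by
    have hj := Complex.hasSum_re (h s e (b j) (b j))
    simp only [inner_right_rankOne_apply, _root_.smul_apply, inner_smul_right,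
      Complex.re_ofReal_mul] at hj
    simp only [← inner_conj_symm v, ← inner_conj_symm u, key] at hj
    exact hj
  have h2 := (hasSum_norm_sq_inner_tensor b e v).prod_fiberwise h1
  rw [h2.unique (hasSum_fintype _), ← Finset.mul_sum, b.sum_sq_norm_inner_right]

end PartialTrace

open InnerProductSpace

/-! ### The scalar factor along a path -/

namespace QuantumCircuit

variable {H A : Type*} [NormedAddCommGroup H] [InnerProductSpace ℂ H] [CompleteSpace H]
  [NormedAddCommGroup A] [InnerProductSpace ℂ A]

theorem out_add (C : QuantumCircuit H A) (μ : C.Path) (ρ ρ' : H →L[ℂ] H) :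
    C.out μ (tensorKetBra (ρ + ρ') C.ancilla) =
      C.out μ (tensorKetBra ρ C.ancilla) + C.out μ (tensorKetBra ρ' C.ancilla) := by
  ext x
  simp [out, tensorKetBra]

theorem out_rankOne (C : QuantumCircuit H A) (μ : C.Path) (ψ : H) :
    C.out μ (tensorKetBra (rankOne ℂ ψ ψ) C.ancilla) =
      rankOne ℂ (C.pathOp μ (tensorRight H C.ancilla ψ))
        (C.pathOp μ (tensorRight H C.ancilla ψ)) := by
  simp only [out, tensorKetBra, rankOne_comp, comp_rankOne,
    ContinuousLinearMap.adjoint_adjoint]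

variable [FiniteDimensional ℂ H] {C : QuantumCircuit H A} {μ : C.Path}
  {U : H →L[ℂ] H}

theorem ComputesAlong.exists_isPartialTrace (h : C.ComputesAlong μ U) {ψ : H} (hψ : ψ ≠ 0) :
    ∃ c : ℝ, IsPartialTrace (C.out μ (tensorKetBra (rankOne ℂ ψ ψ) C.ancilla))
      ((c : ℂ) • rankOne ℂ (U ψ) (U ψ)) := by
  obtain ⟨c, -, hc⟩ := h _ (isDensity_of_finiteDimensional (rankOne_ne_zero hψ hψ)
    (isPositive_rankOne_self ψ))
  refine ⟨c, ?_⟩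
  rwa [rankOne_comp, comp_rankOne, ContinuousLinearMap.adjoint_adjoint] at hc

variable [CompleteSpace A]

theorem ComputesAlong.pathOp_eq_zero (h : C.ComputesAlong μ U) {ψ : H} (hψ : U ψ = 0) :
    C.pathOp μ (tensorRight H C.ancilla ψ) = 0 := by
  rcases eq_or_ne ψ 0 with rfl | h0
  · simp
  · obtain ⟨c, hc⟩ := h.exists_isPartialTrace h0
    rw [out_rankOne] at hc
    simpa [hψ] using hc.norm_sq_eq

/-- The factor c in `ComputesAlong` may a priori vary with the input; the point is that linearity of
the output in ρ forces the same c for ψ and φ. -/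
theorem ComputesAlong.norm_pathOp_eq (h : C.ComputesAlong μ U) (hinj : Function.Injective U)
    {ψ φ : H} (hn : ‖U ψ‖ = ‖U φ‖) :
    ‖C.pathOp μ (tensorRight H C.ancilla ψ)‖ = ‖C.pathOp μ (tensorRight H C.ancilla φ)‖ := by
  rcases eq_or_ne ψ 0 with rfl | hψ
  · have : φ = 0 := hinj (by simpa using hn.symm)
    rw [this]
  rcases eq_or_ne φ 0 with rfl | hφ
  · exact absurd (hinj (by simpa using hn)) hψ
  by_cases hli : LinearIndependent ℂ ![U ψ, U φ]
  · obtain ⟨c, hc⟩ := h.exists_isPartialTrace hψ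
    obtain ⟨d, hd⟩ := h.exists_isPartialTrace hφ
    have hpos : (rankOne ℂ ψ ψ + rankOne ℂ φ φ).IsPositive :=
      (isPositive_rankOne_self ψ).add (isPositive_rankOne_self φ)
    have hne : rankOne ℂ ψ ψ + rankOne ℂ φ φ ≠ 0 := fun h0 => by
      have h1 := congrArg (fun T : H →L[ℂ] H => (inner ℂ ψ (T ψ) : ℂ).re) h0
      have h2 := (isPositive_rankOne_self (𝕜 := ℂ) φ).re_inner_nonneg_right ψ
      have h3 : (inner ℂ ψ (rankOne ℂ ψ ψ ψ) : ℂ).re = (‖ψ‖ ^ 2) ^ 2 := by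
        rw [inner_right_rankOne_apply, inner_self_eq_norm_sq_to_K, ← mul_pow]
        change (((‖ψ‖ : ℂ) * (‖ψ‖ : ℂ)) ^ 2).re = _
        rw [← Complex.ofReal_mul, ← Complex.ofReal_pow, Complex.ofReal_re, ← pow_two]
      have h4 : 0 < ‖ψ‖ := norm_pos_iff.2 hψ
      simp only [_root_.add_apply, inner_add_right, Complex.add_re, h3,
        _root_.zero_apply, inner_zero_right, Complex.zero_re] at h1
      have h5 : 0 < (‖ψ‖ ^ 2) ^ 2 := by positivity
      change 0 ≤ (inner ℂ ψ (rankOne ℂ φ φ ψ) : ℂ).re at h2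
      linarith
    obtain ⟨r, -, hr⟩ := h _ (isDensity_of_finiteDimensional hne hpos)
    rw [out_add] at hr
    have heq := hr.unique (hc.add hd)
    -- The factor `r` of the summed input satisfies r(P + Q) = cP + dQ, where P = |Uψ⟩⟨Uψ| and Q =
    -- |Uφ⟩⟨Uφ|. Evaluating at Uψ and at Uφ then gives r = c and r = d.
    have hlin : ∀ u, ((r - c : ℂ) * inner ℂ (U ψ) u) • U ψ
        + ((r - d : ℂ) * inner ℂ (U φ) u) • U φ = 0 := fun u => by
      have hu := DFunLike.congr_fun heq u
      simp only [ContinuousLinearMap.add_comp, ContinuousLinearMap.comp_add, rankOne_comp,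
        comp_rankOne, ContinuousLinearMap.adjoint_adjoint, _root_.smul_apply,
        _root_.add_apply, rankOne_apply] at hu
      rw [← sub_eq_zero] at hu
      rw [← hu]
      module
    have hcoef : ∀ u, (r - c : ℂ) * inner ℂ (U ψ) u = 0 ∧ (r - d : ℂ) * inner ℂ (U φ) u = 0 :=
      fun u => LinearIndependent.pair_iff.1 hli _ _ (hlin u)
    have hUψ : U ψ ≠ 0 := fun h0 => hψ (hinj (by simpa using h0))
    have hUφ : U φ ≠ 0 := fun h0 => hφ (hinj (by simpa using h0))
    have h1 : (r : ℂ) = c := by simpa [hUψ, sub_eq_zero] using (hcoef (U ψ)).1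
    have h2 : (r : ℂ) = d := by simpa [hUφ, sub_eq_zero] using (hcoef (U φ)).2
    have h3 : c = d := by exact_mod_cast h1.symm.trans h2
    rw [out_rankOne] at hc hd
    rw [← sq_eq_sq₀ (norm_nonneg _) (norm_nonneg _), hc.norm_sq_eq, hd.norm_sq_eq, h3, hn]
  -- In the dependent case, injectivity makes φ a multiple of ψ, and equal norms make the multiple a
  -- phase.
  · have hUψ : U ψ ≠ 0 := fun h0 => hψ (hinj (by simpa using h0))
    rw [LinearIndependent.pair_iff' hUψ] at hli
    push Not at hli
    obtain ⟨z, hz⟩ := hli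
    have hφz : φ = z • ψ := hinj (by rw [map_smul, hz])
    have hz1 : ‖z‖ = 1 := by
      rw [← hz, norm_smul] at hn
      exact (mul_eq_right₀ (norm_ne_zero_iff.2 hUψ)).1 hn.symm
    rw [hφz, map_smul, map_smul, norm_smul, hz1, one_mul]

end QuantumCircuit

/-! ### The corollary -/

theorem corollaryB3 {H A : Type*}
    [NormedAddCommGroup H] [InnerProductSpace ℂ H] [CompleteSpace H] [FiniteDimensional ℂ H]
    [NormedAddCommGroup A] [InnerProductSpace ℂ A] [CompleteSpace A]
    (C : QuantumCircuit H A) (U : H →L[ℂ] H)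
    (hU : ∀ μ : C.Path, C.ComputesAlong μ U) :
    ∃ (t : ℝ) (V : H →L[ℂ] H),
      0 < t ∧ V ∈ unitary (H →L[ℂ] H) ∧ U = (t : ℂ) • V := by
  have hin : ∀ ψ, ‖tensorRight H C.ancilla ψ‖ = ‖ψ‖ := fun ψ => by
    rw [norm_tensorRight, C.norm_ancilla, mul_one]
  have hinj : Function.Injective U := by
    refine (injective_iff_map_eq_zero U).2 fun ψ hψ => ?_
    have := C.norm_eq_of_forall_norm_pathOp_eq (x := tensorRight H C.ancilla ψ) (y := 0)
      fun μ => by rw [(hU μ).pathOp_eq_zero hψ, map_zero]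
    simpa [hin] using this
  have hnorm : ∀ ψ φ, ‖U ψ‖ = ‖U φ‖ → ‖ψ‖ = ‖φ‖ := fun ψ φ h => by
    rw [← hin ψ, ← hin φ]
    exact C.norm_eq_of_forall_norm_pathOp_eq fun μ => (hU μ).norm_pathOp_eq hinj h
  rcases subsingleton_or_nontrivial H with hH | hH
  · exact ⟨1, 1, one_pos, one_mem _, Subsingleton.elim _ _⟩
  obtain ⟨ψ₀, hψ₀⟩ := exists_norm_eq H zero_le_one
  have ht : 0 < ‖U ψ₀‖ := norm_pos_iff.2 fun h0 => by
    have : ψ₀ = 0 := hinj (by simpa using h0)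
    simp [this] at hψ₀
  have hscale : ∀ φ, ‖U φ‖ = ‖U ψ₀‖ * ‖φ‖ := fun φ => by
    -- The multiple of ψ₀ is scaled so that its image under U has norm ‖U φ‖.
    have h := hnorm φ (((‖U φ‖ / ‖U ψ₀‖ : ℝ) : ℂ) • ψ₀) (by
      rw [map_smul, norm_smul, Complex.norm_real, Real.norm_of_nonneg (by positivity)]
      field_simp)
    rw [norm_smul, Complex.norm_real, Real.norm_of_nonneg (by positivity), hψ₀] at h
    rw [h]
    field_simp
  set t := ‖U ψ₀‖
  have htc : (t : ℂ) ≠ 0 := by exact_mod_cast ht.ne'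
  let V : H →L[ℂ] H := (t : ℂ)⁻¹ • U
  have hV : ∀ x, ‖V x‖ = ‖x‖ := fun x => by
    simp only [V, _root_.smul_apply, norm_smul, norm_inv, Complex.norm_real,
      Real.norm_of_nonneg ht.le, hscale]
    field_simp
  have hVl : star V * V = 1 := (ContinuousLinearMap.norm_map_iff_adjoint_comp_self V).1 hV
  -- In finite dimension a left inverse is also a right inverse.
  have hVr : V * star V = 1 := by
    have hl : ((star V : H →L[ℂ] H) : H →ₗ[ℂ] H) * (V : H →ₗ[ℂ] H) = 1 := by
      rw [← ContinuousLinearMap.toLinearMap_mul, hVl]; rfl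
    have hr := mul_eq_one_comm.1 hl
    exact ContinuousLinearMap.ext fun x => LinearMap.congr_fun hr x
  exact ⟨t, V, ht, Unitary.mem_iff.2 ⟨hVl, hVr⟩, by rw [smul_smul, mul_inv_cancel₀ htc, one_smul]⟩
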